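/- Let $A=(a_1,\dots,a_n)$ be a sequence of $n$ distinct integers. A set $I\subseteq\{1,\dots,n\}$ is *feasible* for $A$ if $a_i<a_j$ for all $i,j\in I$ with $i<j$, and it is a *maximum feasible set* if no feasible set has strictly larger cardinality. A *reconfiguration sequence* between two feasible sets $I$ and $J$ is a sequence of feasible sets $I_0,I_1,\dots,I_\ell$ ($\ell\ge 0$) with $I_0=I$, $I_\ell=J$, such that for each $1\le i\le\ell$ one has $I_i=(I_{i-1}\cup\{j\})\setminus\{k\}$ for some $j\notin I_{i-1}$ and $k\in I_{i-1}$. **Theorem.** *Longest Increasing Subsequence Reconfiguration* can be decided in polynomial time. That is, there is a deterministic algorithm (a single program for a random access machine with addition, subtraction, sign tests and indirect addressing, under the logarithmic cost measure) which, given any finite sequence $A$ of distinct integers and two maximum feasible sets $I$ and $J$ for $A$, decides whether there is a reconfiguration sequence between $I$ and $J$, in time bounded by a polynomial in the number of bits of the input $(n; a_1,\dots,a_n; I; J)$, where integers are written in binary and $I$ and $J$ are given by their indicator vectors. -/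

import Mathlib

/-! ### Increasing subsequences and their reconfiguration -/

/-- A set `I` of indices is feasible for the sequence `A` if it is the index set of an
increasing subsequence of `A`. -/
def Feasible {n : ℕ} (A : Fin n → ℤ) (I : Finset (Fin n)) : Prop :=
  ∀ i ∈ I, ∀ j ∈ I, i < j → A i < A j

/-- A feasible set such that no feasible set has strictly larger cardinality. -/
def IsMaximumFeasible {n : ℕ} (A : Fin n → ℤ) (I : Finset (Fin n)) : Prop :=
  Feasible A I ∧ ¬ ∃ K : Finset (Fin n), Feasible A K ∧ I.card < K.card

/-- `I'` arises from `I` by simultaneously adding some `j ∉ I` and removing some `k ∈ I`. -/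
def ExchangeStep {n : ℕ} (I I' : Finset (Fin n)) : Prop :=
  ∃ j k : Fin n, j ∉ I ∧ k ∈ I ∧ I' = (I ∪ {j}) \ {k}

/-- There is a reconfiguration sequence `S 0 = I, S 1, …, S l = J` of feasible sets in which
each set is obtained from the previous one by a single exchange. -/
def Reconfigurable {n : ℕ} (A : Fin n → ℤ) (I J : Finset (Fin n)) : Prop :=
  ∃ (l : ℕ) (S : ℕ → Finset (Fin n)), S 0 = I ∧ S l = J ∧
    (∀ i ≤ l, Feasible A (S i)) ∧ ∀ i < l, ExchangeStep (S i) (S (i + 1))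

/-- An instance of Longest Increasing Subsequence Reconfiguration: a sequence of `n` distinct
integers together with two maximum feasible sets. -/
structure LISRInstance where
  n : ℕ
  A : Fin n → ℤ
  distinct : Function.Injective A
  I : Finset (Fin n)
  J : Finset (Fin n)
  maxI : IsMaximumFeasible A I
  maxJ : IsMaximumFeasible A J

/-- The question asked about an instance. -/
def LISRInstance.IsYes (x : LISRInstance) : Prop := Reconfigurable x.A x.I x.J

/-- The list of integers `n, a₁, …, aₙ, χ_I(1), …, χ_I(n), χ_J(1), …, χ_J(n)` describing an
instance, where `χ` denotes the 0-1 indicator of a set. -/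
def LISRInstance.encode (x : LISRInstance) : List ℤ :=
  (x.n : ℤ) :: (List.ofFn x.A
    ++ List.ofFn (fun i => if i ∈ x.I then (1 : ℤ) else 0)
    ++ List.ofFn (fun i => if i ∈ x.J then (1 : ℤ) else 0))

/-! ### Random access machines with logarithmic cost -/

namespace RAM

/-- The memory: registers addressed by integers, each of which holds an integer. -/
abbrev Mem : Type := ℤ → ℤ

/-- The number of bits of an integer in binary, including one for the sign. -/
def bits (z : ℤ) : ℕ := Nat.size z.natAbs + 1

/-- Programs of a random access machine. The letters `d`, `a`, `b` are fixed register
addresses; `load` and `store` use indirect addressing. -/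
inductive Prog : Type
  /-- do nothing -/
  | skip : Prog
  /-- `R[d] := c` -/
  | const (d c : ℤ) : Prog
  /-- `R[d] := R[a] + R[b]` -/
  | add (d a b : ℤ) : Prog
  /-- `R[d] := R[a] - R[b]` -/
  | sub (d a b : ℤ) : Prog
  /-- `R[d] := R[R[a]]` -/
  | load (d a : ℤ) : Prog
  /-- `R[R[d]] := R[a]` -/
  | store (d a : ℤ) : Prog
  /-- first `p`, then `q` -/
  | seq (p q : Prog) : Prog
  /-- if `R[a] > 0` then `p` else `q` -/
  | ifPos (a : ℤ) (p q : Prog) : Prog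
  /-- while `R[a] > 0` do `p` -/
  | whilePos (a : ℤ) (p : Prog) : Prog

/-- `Exec p m m' t`: started in memory `m`, the program `p` halts in memory `m'` after a
computation of total cost `t`. Every executed operation and every executed test is charged
the number of bits of all addresses and operands that occur in it (logarithmic cost). -/
inductive Exec : Prog → Mem → Mem → ℕ → Prop
  | skip (m : Mem) : Exec .skip m m 1
  | const (d c : ℤ) (m : Mem) :
      Exec (.const d c) m (Function.update m d c) (bits d + bits c)
  | add (d a b : ℤ) (m : Mem) :
      Exec (.add d a b) m (Function.update m d (m a + m b))
        (bits d + bits a + bits b + bits (m a) + bits (m b))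
  | sub (d a b : ℤ) (m : Mem) :
      Exec (.sub d a b) m (Function.update m d (m a - m b))
        (bits d + bits a + bits b + bits (m a) + bits (m b))
  | load (d a : ℤ) (m : Mem) :
      Exec (.load d a) m (Function.update m d (m (m a)))
        (bits d + bits a + bits (m a) + bits (m (m a)))
  | store (d a : ℤ) (m : Mem) :
      Exec (.store d a) m (Function.update m (m d) (m a))
        (bits d + bits (m d) + bits a + bits (m a))
  | seq {p q : Prog} {m₁ m₂ m₃ : Mem} {s t : ℕ} :
      Exec p m₁ m₂ s → Exec q m₂ m₃ t → Exec (.seq p q) m₁ m₃ (s + t)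
  | ifTrue {a : ℤ} {p q : Prog} {m m' : Mem} {t : ℕ} :
      0 < m a → Exec p m m' t → Exec (.ifPos a p q) m m' (bits a + bits (m a) + t)
  | ifFalse {a : ℤ} {p q : Prog} {m m' : Mem} {t : ℕ} :
      ¬ 0 < m a → Exec q m m' t → Exec (.ifPos a p q) m m' (bits a + bits (m a) + t)
  | whileTrue {a : ℤ} {p : Prog} {m₁ m₂ m₃ : Mem} {s t : ℕ} :
      0 < m₁ a → Exec p m₁ m₂ s → Exec (.whilePos a p) m₂ m₃ t →
        Exec (.whilePos a p) m₁ m₃ (bits a + bits (m₁ a) + s + t)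
  | whileFalse {a : ℤ} {p : Prog} {m : Mem} :
      ¬ 0 < m a → Exec (.whilePos a p) m m (bits a + bits (m a))

/-- Computations are deterministic: the final memory and the cost depend only on the program
and the initial memory. -/
theorem Exec.deterministic {p : Prog} {m m₁ : Mem} {t₁ : ℕ} (h₁ : Exec p m m₁ t₁) :
    ∀ {m₂ : Mem} {t₂ : ℕ}, Exec p m m₂ t₂ → m₁ = m₂ ∧ t₁ = t₂ := by
  induction h₁ with
  | seq _ _ ih₁ ih₂ =>
    intro m₂ t₂ h
    cases h with
    | seq h h' =>
      obtain ⟨rfl, rfl⟩ := ih₁ h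
      obtain ⟨rfl, rfl⟩ := ih₂ h'
      exact ⟨rfl, rfl⟩
  | ifTrue hp _ ih =>
    intro m₂ t₂ h
    cases h with
    | ifTrue _ h => obtain ⟨rfl, rfl⟩ := ih h; exact ⟨rfl, rfl⟩
    | ifFalse hn _ => exact absurd hp hn
  | ifFalse hn _ ih =>
    intro m₂ t₂ h
    cases h with
    | ifTrue hp _ => exact absurd hp hn
    | ifFalse _ h => obtain ⟨rfl, rfl⟩ := ih h; exact ⟨rfl, rfl⟩
  | whileTrue hp _ _ ih₁ ih₂ =>
    intro m₂ t₂ h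
    cases h with
    | whileTrue _ h h' =>
      obtain ⟨rfl, rfl⟩ := ih₁ h
      obtain ⟨rfl, rfl⟩ := ih₂ h'
      exact ⟨rfl, rfl⟩
    | whileFalse hn => exact absurd hp hn
  | whileFalse hn =>
    intro m₂ t₂ h
    cases h with
    | whileTrue hp _ _ => exact absurd hp hn
    | whileFalse _ => exact ⟨rfl, rfl⟩
  | _ => intro m₂ t₂ h; cases h; exact ⟨rfl, rfl⟩

/-- The initial memory on an input list: the entries of the list are stored in the registers
`0, 1, 2, …`, and all other registers hold `0`. -/
def initMem (w : List ℤ) : Mem := fun z => if 0 ≤ z then w.getD z.toNat 0 else 0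

/-- The size of an input list: the total number of bits of its entries. -/
def inputSize (w : List ℤ) : ℕ := (w.map bits).sum

/-- The (promise) decision problem with instances `α`, encoded by `enc`, and yes-instances
`Yes` is decided by one fixed program in time bounded by a polynomial in the input size.
The answer is left in register `0`. -/
def DecidableInPolyTime {α : Type*} (enc : α → List ℤ) (Yes : α → Prop) : Prop :=
  ∃ (p : Prog) (T : Polynomial ℕ), ∀ x : α, ∃ (m : Mem) (t : ℕ),
    Exec p (initMem (enc x)) m t ∧ t ≤ T.eval (inputSize (enc x)) ∧
      (Yes x → m 0 = 1) ∧ (¬ Yes x → m 0 = 0)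

end RAM

/-! Give each index a level: the length of a longest increasing subsequence strictly before and
below it. A maximum feasible set has exactly one member on every level that occurs
(`IsMaximumFeasible.exists_level_eq`, `Feasible.injOn_level`), and on one level larger indices carry
smaller values (`lt_of_level_eq`). Two maximum feasible sets can therefore be compared level by
level.

Call an exchange a lowering if it replaces a member by a smaller index. Greedy lowering stops,
because the sum of the indices drops. The key point is `Reconfigurable.le_of_not_canLower`: a set
that admits no lowering is levelwise below everything reachable from it. Since reachability is
symmetric, each reconfiguration class contains exactly one such set, a canonical form. Hence the
answer is yes if and only if the canonical forms of the two given sets coincide.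

The program lowers both sets exhaustively and compares them. The index sum is at most `n * n`, which
bounds the number of sweeps; a sweep tries all pairs, and each pair costs one pass over the indices.
Step counts yield bit costs because a step lengthens stored integers by at most one bit (`Run`,
`DecidableInPolyTime.of_run`). -/

/-! ### Levels of indices and canonical forms -/

section Levels

variable {n : ℕ} {A : Fin n → ℤ}

open Classical in
/-- The largest size of an increasing subsequence all of whose members precede and are smaller
than the member with index `i`. -/
noncomputable def level (A : Fin n → ℤ) (i : Fin n) : ℕ :=
  ({K : Finset (Fin n) | Feasible A K ∧ ∀ j ∈ K, j < i ∧ A j < A i} : Finset _).sup Finset.card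

theorem exists_card_eq_level (A : Fin n → ℤ) (i : Fin n) :
    ∃ K : Finset (Fin n), Feasible A K ∧ (∀ j ∈ K, j < i ∧ A j < A i) ∧ K.card = level A i := by
  classical
  obtain ⟨K, hK, h⟩ := Finset.exists_mem_eq_sup
    ({K : Finset (Fin n) | Feasible A K ∧ ∀ j ∈ K, j < i ∧ A j < A i} : Finset _)
    ⟨∅, by rw [Finset.mem_filter]; simp [Feasible]⟩ Finset.card
  simp only [Finset.mem_filter, Finset.mem_univ, true_and] at hK
  exact ⟨K, hK.1, hK.2, h.symm⟩

theorem card_le_level {i : Fin n} {K : Finset (Fin n)} (hK : Feasible A K)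
    (h : ∀ j ∈ K, j < i ∧ A j < A i) : K.card ≤ level A i := by
  classical
  exact Finset.le_sup (f := Finset.card) (by simpa using ⟨hK, h⟩)

theorem exists_feasible_card_eq_level_succ (A : Fin n → ℤ) (i : Fin n) :
    ∃ K : Finset (Fin n), Feasible A K ∧ (∀ j ∈ K, j ≤ i ∧ A j ≤ A i) ∧
      K.card = level A i + 1 := by
  obtain ⟨K, hK, hlt, hc⟩ := exists_card_eq_level A i
  have hi : i ∉ K := fun h => lt_irrefl _ (hlt i h).1
  refine ⟨insert i K, ?_, ?_, by rw [Finset.card_insert_of_notMem hi, hc]⟩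
  · intro x hx y hy hxy
    rcases Finset.mem_insert.1 hx with hx | hx <;> rcases Finset.mem_insert.1 hy with hy | hy
    · exact absurd hxy (hx.trans hy.symm).not_lt
    · exact absurd hxy (hx ▸ (hlt y hy).1.not_gt)
    · exact hy ▸ (hlt x hx).2
    · exact hK x hx y hy hxy
  · intro j hj
    rcases Finset.mem_insert.1 hj with rfl | hj
    · exact ⟨le_rfl, le_rfl⟩
    · exact ⟨(hlt j hj).1.le, (hlt j hj).2.le⟩

/-- An optimal set for `i`, extended by `i` itself, competes for the level of `j`. -/
theorem level_lt_level {i j : Fin n} (h : i < j) (hA : A i < A j) : level A i < level A j := by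
  obtain ⟨K, hK, hle, hc⟩ := exists_feasible_card_eq_level_succ A i
  have := card_le_level hK fun x hx => ⟨(hle x hx).1.trans_lt h, (hle x hx).2.trans_lt hA⟩
  omega

theorem IsMaximumFeasible.level_lt {I : Finset (Fin n)} (hI : IsMaximumFeasible A I) (i : Fin n) :
    level A i < I.card := by
  obtain ⟨K, hK, -, hc⟩ := exists_feasible_card_eq_level_succ A i
  by_contra h
  exact hI.2 ⟨K, hK, by omega⟩

theorem Feasible.lt_of_level_lt {I : Finset (Fin n)} (hI : Feasible A I) {i j : Fin n}
    (hi : i ∈ I) (hj : j ∈ I) (h : level A i < level A j) : i < j := by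
  rcases lt_trichotomy i j with h' | rfl | h'
  · exact h'
  · exact absurd h (lt_irrefl _)
  · exact absurd h (level_lt_level h' (hI j hj i hi h')).not_gt

theorem Feasible.injOn_level {I : Finset (Fin n)} (hI : Feasible A I) :
    Set.InjOn (level A) I := by
  intro i hi j hj h
  rcases lt_trichotomy i j with h' | h' | h'
  · exact absurd h (level_lt_level h' (hI i hi j hj h')).ne
  · exact h'
  · exact absurd h (level_lt_level h' (hI j hj i hi h')).ne'

/-- Pigeonhole: the members of `I` have distinct levels, all below `I.card`, so every value below
`I.card` is attained, and no index has a larger level. -/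
theorem IsMaximumFeasible.exists_level_eq {I : Finset (Fin n)} (hI : IsMaximumFeasible A I)
    (i : Fin n) : ∃ x ∈ I, level A x = level A i := by
  have h := Finset.surj_on_of_inj_on_of_card_le (s := I) (t := Finset.range I.card)
    (fun x _ => level A x) (fun x _ => Finset.mem_range.2 (hI.level_lt x))
    (fun x y hx hy h => hI.1.injOn_level hx hy h) (by simp) (level A i)
    (Finset.mem_range.2 (hI.level_lt i))
  obtain ⟨x, hx, h⟩ := h
  exact ⟨x, hx, h.symm⟩

theorem lt_of_level_eq (hA : Function.Injective A) {i j : Fin n} (h : level A i = level A j)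
    (hij : i < j) : A j < A i := by
  rcases lt_trichotomy (A i) (A j) with h' | h' | h'
  · exact absurd h (level_lt_level hij h').ne
  · exact absurd (hA h') hij.ne
  · exact h'

/-! ### Exchanges, reachability and lowering -/

/-- The member `k` of `S` can be replaced by the earlier index `j`. -/
def CanLower (A : Fin n → ℤ) (S : Finset (Fin n)) (j k : Fin n) : Prop :=
  k ∈ S ∧ j ∉ S ∧ j < k ∧ ∀ i ∈ S, i ≠ k → (i < j → A i < A j) ∧ (j < i → A j < A i)

theorem ExchangeStep.card_eq {I I' : Finset (Fin n)} (h : ExchangeStep I I') :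
    I'.card = I.card := by
  obtain ⟨j, k, hj, hk, rfl⟩ := h
  rw [Finset.card_sdiff_of_subset (by simp [hk]), Finset.card_union_of_disjoint (by simpa using hj)]
  simp

theorem ExchangeStep.symm {I I' : Finset (Fin n)} (h : ExchangeStep I I') :
    ExchangeStep I' I := by
  obtain ⟨j, k, hj, hk, rfl⟩ := h
  have hjk : j ≠ k := fun h => hj (h ▸ hk)
  refine ⟨k, j, by simp, by simp [hjk], ?_⟩
  ext x
  simp only [Finset.mem_sdiff, Finset.mem_union, Finset.mem_singleton]
  by_cases h1 : x = j
  · simp [h1, hj]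
  · by_cases h2 : x = k <;> simp [h1, h2, hk]
    exact fun h => h1 (h2.trans h)

theorem IsMaximumFeasible.of_exchangeStep {I I' : Finset (Fin n)} (hI : IsMaximumFeasible A I)
    (h : ExchangeStep I I') (hI' : Feasible A I') : IsMaximumFeasible A I' :=
  ⟨hI', by rw [h.card_eq]; exact hI.2⟩

theorem Reconfigurable.refl {I : Finset (Fin n)} (hI : Feasible A I) : Reconfigurable A I I :=
  ⟨0, fun _ => I, rfl, rfl, fun _ _ => hI, fun _ h => absurd h (Nat.not_lt_zero _)⟩

theorem Reconfigurable.symm {I J : Finset (Fin n)} (h : Reconfigurable A I J) :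
    Reconfigurable A J I := by
  obtain ⟨l, S, h0, hl, hf, hs⟩ := h
  refine ⟨l, fun i => S (l - i), by simpa, by simpa, fun i _ => hf _ (Nat.sub_le _ _),
    fun i hi => ?_⟩
  have := (hs (l - (i + 1)) (by omega)).symm
  rwa [show l - (i + 1) + 1 = l - i by omega] at this

theorem Reconfigurable.trans {I J K : Finset (Fin n)} (h : Reconfigurable A I J)
    (h' : Reconfigurable A J K) : Reconfigurable A I K := by
  obtain ⟨l, S, h0, hl, hf, hs⟩ := h
  obtain ⟨l', S', h0', hl', hf', hs'⟩ := h'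
  refine ⟨l + l', fun i => if i ≤ l then S i else S' (i - l), by simpa, ?_, fun i hi => ?_,
    fun i hi => ?_⟩
  · rcases Nat.eq_zero_or_pos l' with rfl | h
    · simp [hl, ← h0', hl']
    · simp [h.ne', hl']
  · dsimp only
    split_ifs with h
    · exact hf i h
    · exact hf' _ (by omega)
  · dsimp only
    rcases lt_trichotomy i l with h | rfl | h
    · simpa [h.le, show i + 1 ≤ l from h] using hs i h
    · simpa [hl, h0'] using hs' 0 (by omega)
    · have := hs' (i - l) (by omega)
      rw [if_neg (by omega), if_neg (by omega), show i + 1 - l = i - l + 1 by omega]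
      exact this

theorem Reconfigurable.isMaximumFeasible {I J : Finset (Fin n)} (h : Reconfigurable A I J)
    (hI : IsMaximumFeasible A I) : IsMaximumFeasible A J := by
  obtain ⟨l, S, rfl, rfl, hf, hs⟩ := h
  suffices ∀ i ≤ l, IsMaximumFeasible A (S i) from this l le_rfl
  intro i
  induction i with
  | zero => exact fun _ => hI
  | succ i ih => exact fun hi => (ih (by omega)).of_exchangeStep (hs i hi) (hf _ hi)

theorem CanLower.reconfigurable {S : Finset (Fin n)} {j k : Fin n} (h : CanLower A S j k)
    (hS : Feasible A S) : Reconfigurable A S ((S ∪ {j}) \ {k}) := by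
  obtain ⟨hk, hj, hjk, hC⟩ := h
  have hf : Feasible A ((S ∪ {j}) \ {k}) := by
    intro x hx y hy hxy
    simp only [Finset.mem_sdiff, Finset.mem_union, Finset.mem_singleton] at hx hy
    obtain ⟨hx | rfl, hxk⟩ := hx <;> obtain ⟨hy | rfl, hyk⟩ := hy
    · exact hS x hx y hy hxy
    · exact (hC x hx hxk).1 hxy
    · exact (hC y hy hyk).2 hxy
    · exact absurd hxy (lt_irrefl _)
  refine ⟨1, fun i => if i = 0 then S else (S ∪ {j}) \ {k}, rfl, rfl, fun i _ => ?_,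
    fun i hi => ?_⟩
  · dsimp only
    split_ifs
    exacts [hS, hf]
  · obtain rfl : i = 0 := by omega
    exact ⟨j, k, hj, hk, rfl⟩

/-- The index sum is the termination measure of greedy lowering. -/
theorem CanLower.sum_lt {S : Finset (Fin n)} {j k : Fin n} (h : CanLower A S j k) :
    ∑ i ∈ (S ∪ {j}) \ {k}, (i : ℕ) < ∑ i ∈ S, (i : ℕ) := by
  obtain ⟨hk, hj, hjk, -⟩ := h
  have h1 := Finset.sum_sdiff (f := fun i : Fin n => (i : ℕ)) (s₁ := {k}) (s₂ := S ∪ {j})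
    (by simp [hk])
  rw [Finset.sum_union (by simpa using hj)] at h1
  simp only [Finset.sum_singleton] at h1
  have : (j : ℕ) < k := hjk
  omega

/-! ### Uniqueness of canonical forms -/

/-- A maximum feasible set that cannot be lowered lies levelwise below everything that can be
reached from it. -/
theorem Reconfigurable.le_of_not_canLower (hA : Function.Injective A) {I J : Finset (Fin n)}
    (h : Reconfigurable A I J) (hI : IsMaximumFeasible A I) (hmin : ∀ j k, ¬ CanLower A I j k) :
    ∀ x ∈ I, ∀ y ∈ J, level A x = level A y → x ≤ y := by
  obtain ⟨l, S, h0, rfl, hf, hs⟩ := h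
  have hmax : ∀ i ≤ l, IsMaximumFeasible A (S i) := by
    intro i hi
    exact Reconfigurable.isMaximumFeasible
      ⟨i, S, h0, rfl, fun i' h => hf i' (h.trans hi), fun i' h => hs i' (h.trans_le hi)⟩ hI
  suffices ∀ i ≤ l, ∀ x ∈ I, ∀ y ∈ S i, level A x = level A y → x ≤ y from this l le_rfl
  intro i
  induction i with
  | zero =>
    intro _ x hx y hy h
    exact (hI.1.injOn_level hx (h0 ▸ hy) h).le
  | succ i ih =>
    intro hi x hx y hy hxy
    have ih := ih (by omega)
    by_contra hlt
    rw [not_le] at hlt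
    obtain ⟨j, k, hj, hk, hS⟩ := hs i hi
    have hmem : ∀ z ∈ S (i + 1), z ≠ j → z ∈ S i := by
      intro z hz hzj
      rw [hS] at hz
      simp only [Finset.mem_sdiff, Finset.mem_union, Finset.mem_singleton] at hz
      tauto
    -- If `y` is the first element to drop below `I` on its level, then `y` could replace `x` in `I`
    -- itself, contradicting minimality.
    refine hmin y x ⟨hx, fun h => hlt.ne (hI.1.injOn_level h hx hxy.symm), hlt, ?_⟩
    have hyj : y = j := by
      by_contra h
      exact hlt.not_ge (ih x hx y (hmem y hy h) hxy)
    intro z hz hzx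
    have hzl : level A z ≠ level A x := fun h => hzx (hI.1.injOn_level hz hx h)
    -- The partner `s` of `z` on its level was already present before the exchange, so induction
    -- gives `z ≤ s`.
    obtain ⟨s, hs, hsz⟩ := (hmax (i + 1) hi).exists_level_eq z
    have hsj : s ≠ j := by
      rintro rfl
      exact hzl (by rw [← hsz, hxy, hyj])
    have hzs : z ≤ s := ih z hz s (hmem s hs hsj) hsz.symm
    have hSf := (hmax (i + 1) hi).1
    -- Below the level of `x`: `z ≤ s < y` and `A z < A x < A y`. Above it: `y < x < z` and `A y < A
    -- s ≤ A z`.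
    rcases hzl.lt_or_gt with h | h
    · have hz' : z < x := hI.1.lt_of_level_lt hz hx h
      have hzy : z < y := hzs.trans_lt (hSf.lt_of_level_lt hs hy (by omega))
      exact ⟨fun _ => (hI.1 z hz x hx hz').trans (lt_of_level_eq hA hxy.symm hlt),
        fun h => absurd h hzy.not_gt⟩
    · have hz' : x < z := hI.1.lt_of_level_lt hx hz h
      have hys : A y < A s := hSf y hy s hs (hSf.lt_of_level_lt hy hs (by omega))
      refine ⟨fun h => absurd (hlt.trans hz') h.not_gt, fun _ => hys.trans_le ?_⟩
      rcases hzs.eq_or_lt with rfl | h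
      · exact le_rfl
      · exact (lt_of_level_eq hA hsz.symm h).le

/-- Each set is levelwise below the other, so antisymmetry applies on every level. -/
theorem Reconfigurable.eq_of_not_canLower (hA : Function.Injective A) {I J : Finset (Fin n)}
    (h : Reconfigurable A I J) (hI : IsMaximumFeasible A I) (hminI : ∀ j k, ¬ CanLower A I j k)
    (hminJ : ∀ j k, ¬ CanLower A J j k) : I = J := by
  have hJ := h.isMaximumFeasible hI
  have h1 := h.le_of_not_canLower hA hI hminI
  have h2 := h.symm.le_of_not_canLower hA hJ hminJ
  ext x
  constructor
  · intro hx
    obtain ⟨y, hy, hxy⟩ := hJ.exists_level_eq x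
    rwa [le_antisymm (h1 x hx y hy hxy.symm) (h2 y hy x hx hxy)]
  · intro hx
    obtain ⟨y, hy, hxy⟩ := hI.exists_level_eq x
    rwa [le_antisymm (h2 x hx y hy hxy.symm) (h1 y hy x hx hxy)]

end Levels

/-! ### Running programs -/

namespace RAM

theorem bits_le_succ_iff {z : ℤ} {B : ℕ} : bits z ≤ B + 1 ↔ z.natAbs < 2 ^ B := by
  rw [bits, Nat.add_le_add_iff_right, Nat.size_le]

theorem one_le_bits (z : ℤ) : 1 ≤ bits z := by simp [bits]

theorem bits_add_le {x y : ℤ} {B : ℕ} (hx : bits x ≤ B) (hy : bits y ≤ B) :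
    bits (x + y) ≤ B + 1 := by
  obtain ⟨B, rfl⟩ : ∃ C, B = C + 1 := ⟨B - 1, by have := one_le_bits x; omega⟩
  rw [bits_le_succ_iff] at *
  have := Int.natAbs_add_le x y
  rw [pow_succ]
  omega

theorem bits_sub_le {x y : ℤ} {B : ℕ} (hx : bits x ≤ B) (hy : bits y ≤ B) :
    bits (x - y) ≤ B + 1 := by
  rw [sub_eq_add_neg]
  exact bits_add_le hx (by simpa [bits] using hy)

/-- The program `p` leads from memory `m` to memory `m'` in at most `s` elementary steps, each of
which lengthens the stored integers by at most one bit and handles at most five of them. -/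
def Run (p : Prog) (m m' : Mem) (s : ℕ) : Prop :=
  ∀ B, 10 ≤ B → (∀ z, bits (m z) ≤ B) →
    ∃ t, Exec p m m' t ∧ t ≤ s * (5 * (B + s)) ∧ ∀ z, bits (m' z) ≤ B + s

theorem Run.mono {p : Prog} {m m' : Mem} {s s' : ℕ} (h : Run p m m' s) (hs : s ≤ s') :
    Run p m m' s' := by
  intro B hB hm
  obtain ⟨t, he, ht, hm'⟩ := h B hB hm
  exact ⟨t, he, ht.trans (by gcongr), fun z => (hm' z).trans (by gcongr)⟩

theorem Run.seq {p q : Prog} {m₁ m₂ m₃ : Mem} {s t : ℕ} (h : Run p m₁ m₂ s)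
    (h' : Run q m₂ m₃ t) : Run (.seq p q) m₁ m₃ (s + t) := by
  intro B hB hm
  obtain ⟨u, he, hu, hm₂⟩ := h B hB hm
  obtain ⟨v, he', hv, hm₃⟩ := h' (B + s) (by omega) hm₂
  refine ⟨u + v, .seq he he', ?_, fun z => (hm₃ z).trans (by omega)⟩
  calc u + v ≤ s * (5 * (B + (s + t))) + t * (5 * (B + s + t)) := by
        refine add_le_add (hu.trans ?_) hv
        gcongr
        omega
    _ = _ := by ring

theorem Run.of_test {p q : Prog} {m m' : Mem} {s : ℕ} {a : ℤ} (ha : bits a ≤ 10)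
    (h : ∀ t, Exec p m m' t → Exec q m m' (bits a + bits (m a) + t)) (hp : Run p m m' s) :
    Run q m m' (1 + s) := by
  intro B hB hm
  obtain ⟨t, he, ht, hm'⟩ := hp B hB hm
  refine ⟨_, h t he, ?_, fun z => (hm' z).trans (by omega)⟩
  have := hm a
  calc bits a + bits (m a) + t ≤ (B + B) + s * (5 * (B + (1 + s))) := by
        refine add_le_add (by omega) (ht.trans ?_)
        gcongr
        omega
    _ ≤ (1 + s) * (5 * (B + (1 + s))) := by nlinarith

theorem Run.ifTrue {p q : Prog} {m m' : Mem} {s : ℕ} {a : ℤ} (ha : bits a ≤ 10) (h : 0 < m a)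
    (hp : Run p m m' s) : Run (.ifPos a p q) m m' (1 + s) :=
  hp.of_test ha fun _ => .ifTrue h

theorem Run.ifFalse {p q : Prog} {m m' : Mem} {s : ℕ} {a : ℤ} (ha : bits a ≤ 10) (h : ¬ 0 < m a)
    (hq : Run q m m' s) : Run (.ifPos a p q) m m' (1 + s) :=
  hq.of_test ha fun _ => .ifFalse h

theorem Run.whileFalse {p : Prog} {m : Mem} {a : ℤ} (ha : bits a ≤ 10) (h : ¬ 0 < m a) :
    Run (.whilePos a p) m m 1 := by
  intro B hB hm
  have := hm a
  exact ⟨_, .whileFalse h, by omega, fun z => (hm z).trans (by omega)⟩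

theorem Run.whileTrue {p : Prog} {m₁ m₂ m₃ : Mem} {s t : ℕ} {a : ℤ} (ha : bits a ≤ 10)
    (h : 0 < m₁ a) (hp : Run p m₁ m₂ s) (hw : Run (.whilePos a p) m₂ m₃ t) :
    Run (.whilePos a p) m₁ m₃ (1 + (s + t)) := by
  -- A round is costed as one test followed by the composition of the body with the remaining loop.
  refine (hp.seq hw).of_test ha fun u he => ?_
  cases he with
  | seq h₁ h₂ => rw [← add_assoc]; exact .whileTrue h h₁ h₂

/-- A loop with an invariant indexed by a variant that every round decreases. -/
theorem Run.while {p : Prog} {s : ℕ} {a : ℤ} (ha : bits a ≤ 10) (Inv : ℕ → Mem → Prop)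
    (body : ∀ v m, Inv v m → 0 < m a → ∃ m', Run p m m' s ∧ ∃ v' < v, Inv v' m') :
    ∀ v m, Inv v m →
      ∃ m', Run (.whilePos a p) m m' (v * (s + 1) + 1) ∧ ∃ v', Inv v' m' ∧ ¬ 0 < m' a := by
  intro v
  induction v using Nat.strong_induction_on with
  | _ v ih =>
    intro m hm
    by_cases h : 0 < m a
    · obtain ⟨m₁, h₁, v₁, hv, hi⟩ := body v m hm h
      obtain ⟨m₂, h₂, v₂, hi₂, hn⟩ := ih v₁ hv m₁ hi
      refine ⟨m₂, (Run.whileTrue ha h h₁ h₂).mono ?_, v₂, hi₂, hn⟩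
      obtain ⟨w, rfl⟩ : ∃ w, v = w + 1 := ⟨v - 1, by omega⟩
      have : v₁ * (s + 1) ≤ w * (s + 1) := by gcongr; omega
      rw [add_mul]
      omega
    · exact ⟨m, (Run.whileFalse ha h).mono (by omega), v, hm, h⟩

/-! ### Loop-free programs -/

/-- Effect of a program without loops on the memory. -/
def Prog.eval : Prog → Mem → Mem
  | .skip, m => m
  | .const d c, m => Function.update m d c
  | .add d a b, m => Function.update m d (m a + m b)
  | .sub d a b, m => Function.update m d (m a - m b)
  | .load d a, m => Function.update m d (m (m a))
  | .store d a, m => Function.update m (m d) (m a)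
  | .seq p q, m => q.eval (p.eval m)
  | .ifPos a p q, m => if 0 < m a then p.eval m else q.eval m
  | .whilePos _ _, m => m

/-- The number of instructions of a program. -/
def Prog.length : Prog → ℕ
  | .seq p q => p.length + q.length
  | .ifPos _ p q => 1 + (p.length + q.length)
  | .whilePos _ p => 1 + p.length
  | _ => 1

/-- The program has no loops and contains only short constants. -/
def Prog.straight : Prog → Bool
  | .skip => true
  | .const d c => decide (d.natAbs < 512) && decide (c.natAbs < 512)
  | .add d a b => decide (d.natAbs < 512) && decide (a.natAbs < 512) && decide (b.natAbs < 512)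
  | .sub d a b => decide (d.natAbs < 512) && decide (a.natAbs < 512) && decide (b.natAbs < 512)
  | .load d a => decide (d.natAbs < 512) && decide (a.natAbs < 512)
  | .store d a => decide (d.natAbs < 512) && decide (a.natAbs < 512)
  | .seq p q => p.straight && q.straight
  | .ifPos a p q => decide (a.natAbs < 512) && p.straight && q.straight
  | .whilePos _ _ => false

theorem Run.of_update {p : Prog} {m : Mem} {a c : ℤ}
    (h : ∀ B, 10 ≤ B → (∀ z, bits (m z) ≤ B) →
      ∃ t, Exec p m (Function.update m a c) t ∧ t ≤ 5 * B ∧ bits c ≤ B + 1) :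
    Run p m (Function.update m a c) 1 := by
  intro B hB hm
  obtain ⟨t, he, ht, hc⟩ := h B hB hm
  refine ⟨t, he, by omega, fun z => ?_⟩
  rw [Function.update_apply]
  split_ifs
  · exact hc
  · exact (hm z).trans (by omega)

/-- This matches the bound 512 in `Prog.straight` with the condition `10 ≤ B` in `Run`: fixed
addresses and constants never exceed the bit budget. -/
theorem bits_le_ten_iff {z : ℤ} : bits z ≤ 10 ↔ z.natAbs < 512 := bits_le_succ_iff

/-- Reduces loop-free code to computing `eval`; `length` counts both branches of a conditional,
hence is only an upper bound. -/
theorem Prog.run_eval {p : Prog} (hp : p.straight = true) (m : Mem) :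
    Run p m (p.eval m) p.length := by
  induction p generalizing m with
  | skip =>
    intro B hB hm
    exact ⟨1, .skip m, by simp only [length]; omega, fun z => (hm z).trans (by omega)⟩
  | const d c =>
    simp only [straight, Bool.and_eq_true, decide_eq_true_eq, ← bits_le_ten_iff] at hp
    exact Run.of_update fun B hB hm => ⟨_, .const d c m, by omega, by omega⟩
  | add d a b =>
    simp only [straight, Bool.and_eq_true, decide_eq_true_eq, ← bits_le_ten_iff] at hp
    refine Run.of_update fun B hB hm => ⟨_, .add d a b m, ?_, bits_add_le (hm a) (hm b)⟩
    have := hm a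
    have := hm b
    omega
  | sub d a b =>
    simp only [straight, Bool.and_eq_true, decide_eq_true_eq, ← bits_le_ten_iff] at hp
    refine Run.of_update fun B hB hm => ⟨_, .sub d a b m, ?_, bits_sub_le (hm a) (hm b)⟩
    have := hm a
    have := hm b
    omega
  | load d a =>
    simp only [straight, Bool.and_eq_true, decide_eq_true_eq, ← bits_le_ten_iff] at hp
    refine Run.of_update fun B hB hm => ⟨_, .load d a m, ?_, (hm _).trans (by omega)⟩
    have := hm a
    have := hm (m a)
    omega
  | store d a =>
    simp only [straight, Bool.and_eq_true, decide_eq_true_eq, ← bits_le_ten_iff] at hp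
    refine Run.of_update fun B hB hm => ⟨_, .store d a m, ?_, (hm _).trans (by omega)⟩
    have := hm a
    have := hm d
    omega
  | seq p q ihp ihq =>
    simp only [straight, Bool.and_eq_true] at hp
    exact (ihp hp.1 m).seq (ihq hp.2 _)
  | ifPos a p q ihp ihq =>
    simp only [straight, Bool.and_eq_true, decide_eq_true_eq, ← bits_le_ten_iff] at hp
    simp only [eval]
    split_ifs with h
    · exact (Run.ifTrue hp.1.1 h (ihp hp.1.2 m)).mono (by simp only [length]; omega)
    · exact (Run.ifFalse hp.1.1 h (ihq hp.2 m)).mono (by simp only [length]; omega)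
  | whilePos a p => simp [straight] at hp

/-- The program contains no loops and no instruction that can write to address `z`. -/
def Prog.Keeps (z : ℤ) : Prog → Prop
  | .skip => True
  | .const d _ => z ≠ d
  | .add d _ _ => z ≠ d
  | .sub d _ _ => z ≠ d
  | .load d _ => z ≠ d
  | .store _ _ => False
  | .seq p q => p.Keeps z ∧ q.Keeps z
  | .ifPos _ p q => p.Keeps z ∧ q.Keeps z
  | .whilePos _ _ => False

theorem Prog.eval_of_keeps {p : Prog} {z : ℤ} (h : p.Keeps z) (m : Mem) : p.eval m z = m z := by
  induction p generalizing m with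
  | skip => rfl
  | const | add | sub | load => exact Function.update_of_ne h _ _
  | store => exact h.elim
  | seq p q ihp ihq => exact (ihq h.2 _).trans (ihp h.1 m)
  | ifPos a p q ihp ihq =>
    simp only [eval]
    split_ifs
    exacts [ihp h.1 m, ihq h.2 m]
  | whilePos => exact h.elim

/-! ### From step counts to logarithmic cost -/

theorem bits_initMem_le (w : List ℤ) (z : ℤ) : bits (initMem w z) ≤ inputSize w + 1 := by
  unfold initMem
  split_ifs
  · rw [List.getD_eq_getElem?_getD]
    rcases lt_or_ge z.toNat w.length with h | h
    · rw [List.getElem?_eq_getElem h, Option.getD_some]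
      have : bits w[z.toNat] ∈ w.map bits := List.mem_map_of_mem (List.getElem_mem h)
      exact (List.single_le_sum (by simp) _ this).trans (Nat.le_succ _)
    · rw [List.getElem?_eq_none h]
      simp [bits]
  · simp [bits]

theorem length_le_inputSize (w : List ℤ) : w.length ≤ inputSize w := by
  simpa [inputSize, one_le_bits] using List.card_nsmul_le_sum (w.map bits) 1 (by simp [one_le_bits])

/-- If a program solves a decision problem in a number of steps that is polynomial in the length
of the input, then the problem is decidable in polynomial time. -/
theorem DecidableInPolyTime.of_run {α : Type*} {enc : α → List ℤ} {Yes : α → Prop} (p : Prog)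
    (T : Polynomial ℕ)
    (h : ∀ x, ∃ m, Run p (initMem (enc x)) m (T.eval (inputSize (enc x))) ∧
      (Yes x → m 0 = 1) ∧ (¬ Yes x → m 0 = 0)) : DecidableInPolyTime enc Yes := by
  -- This is the bound in `Run` with `s = T` and `B` the input size plus 10.
  refine ⟨p, T * (5 * (Polynomial.X + 10 + T)), fun x => ?_⟩
  obtain ⟨m, hr, hm⟩ := h x
  obtain ⟨t, he, ht, -⟩ := hr (inputSize (enc x) + 10) (by omega)
    fun z => (bits_initMem_le _ z).trans (by omega)
  refine ⟨m, t, he, ht.trans (le_of_eq ?_), hm⟩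
  simp [Polynomial.eval_mul, Polynomial.eval_add]

end RAM

/-! ### The program -/

namespace RAM

local infixr:60 " ;; " => Prog.seq

-- Working registers are negative, since the input occupies addresses from 0 on. The counters `rI`,
-- `rJ`, `rK` hold the index plus one: they stop at 0 and double as addresses of the sequence
-- entries.
local notation "rOne" => (-1 : ℤ)
local notation "rBase" => (-2 : ℤ)
local notation "rFlag" => (-3 : ℤ)
local notation "rK" => (-4 : ℤ)
local notation "rJ" => (-5 : ℤ)
local notation "rI" => (-6 : ℤ)
local notation "rOk" => (-7 : ℤ)
local notation "rD" => (-8 : ℤ)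
local notation "rP" => (-9 : ℤ)
local notation "rX" => (-10 : ℤ)
local notation "rV" => (-11 : ℤ)
local notation "rPj" => (-12 : ℤ)
local notation "rXj" => (-13 : ℤ)
local notation "rAj" => (-14 : ℤ)
local notation "rPk" => (-15 : ℤ)
local notation "rXk" => (-16 : ℤ)

/-- If `R[x] ≤ R[y]`, clear `rOk`. -/
def clearUnlessGT (x y : ℤ) : Prog :=
  .sub rD x y ;; .ifPos rD .skip (.const rOk 0)

/-- Load the data for index `rI`. -/
def checkLoad : Prog :=
  .add rP rBase rI ;; .load rX rP ;; .load rV rI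

/-- Clear `rOk` if the member with index `rI` prevents the exchange of `rK` for `rJ`. -/
def checkTest : Prog :=
  .ifPos rX
    (.sub rD rJ rI ;;
      .ifPos rD (clearUnlessGT rAj rV)
        (.sub rD rI rJ ;;
          .ifPos rD
            (.sub rD rK rI ;;
              .ifPos rD (clearUnlessGT rV rAj)
                (.sub rD rI rK ;; .ifPos rD (clearUnlessGT rV rAj) .skip))
            .skip))
    .skip

/-- Take index `rI` into account, and decrease `rI`. -/
def checkStep : Prog :=
  checkLoad ;; checkTest ;; .sub rI rI rOne

/-- Load the data for indices `rJ` and `rK`. -/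
def tryLoad : Prog :=
  .add rPj rBase rJ ;; .load rXj rPj ;; .load rAj rJ ;; .add rPk rBase rK ;; .load rXk rPk

/-- Set `rOk` if `rJ` is no member, `rK` is a member, and `rJ` is smaller than `rK`. -/
def tryTest : Prog :=
  .ifPos rXj .skip
    (.ifPos rXk (.sub rD rK rJ ;; .ifPos rD (.const rOk 1) .skip) .skip)

/-- Prepare the check of the exchange of `rK` for `rJ`. -/
def tryPrepare : Prog :=
  -- In `add rI 0 rD` the middle 0 is the register holding `n`; adding a zero copies it.
  tryLoad ;; (.const rOk 0 ;; .const rD 0 ;; .add rI 0 rD) ;; tryTest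

/-- If `rOk` is set, exchange the member `rK` for `rJ`. Then decrease `rJ`. -/
def tryFinish : Prog :=
  .ifPos rOk (.store rPj rOne ;; .const rD 0 ;; .store rPk rD ;; .const rFlag 1) .skip ;;
  .sub rJ rJ rOne

/-- Exchange the member `rK` for `rJ` if this is possible. Then decrease `rJ`. -/
def tryStep : Prog :=
  tryPrepare ;; .whilePos rI checkStep ;; tryFinish

/-- Attempt to replace the member `rK` by any smaller index. Then decrease `rK`. -/
def lowerStep : Prog :=
  (.const rD 0 ;; .add rJ 0 rD) ;; .whilePos rJ tryStep ;; .sub rK rK rOne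

/-- Attempt to lower each member. Set `rFlag` if this succeeds at least once. -/
def sweep : Prog :=
  (.const rFlag 0 ;; .const rD 0 ;; .add rK 0 rD) ;; .whilePos rK lowerStep

/-- Lower members as long as possible. -/
def canonicalize : Prog :=
  .const rFlag 1 ;; .whilePos rFlag sweep

/-- Load the indicators of both sets at index `rI`. -/
def compareLoad : Prog :=
  .add rP rBase rI ;; .load rX rP ;; .add rP 0 rI ;; .load rV rP

/-- Clear `rOk` if the loaded indicators differ. -/
def compareTest : Prog :=
  .sub rD rX rV ;;
  .ifPos rD (.const rOk 0) (.sub rD rV rX ;; .ifPos rD (.const rOk 0) .skip)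

/-- Clear `rOk` if the two sets differ at index `rI`. Then decrease `rI`. -/
def compareStep : Prog :=
  compareLoad ;; compareTest ;; .sub rI rI rOne

/-- Canonicalize both sets and compare the results. -/
def decideLISR : Prog :=
  (.const rOne 1 ;; .const rD 0 ;; .add rBase 0 rD) ;; canonicalize ;;
  -- The base becomes `n + n`, the offset of the second indicator block.
  .add rBase 0 0 ;; canonicalize ;;
  (.const rOk 1 ;; .const rD 0 ;; .add rI 0 rD) ;; .whilePos rI compareStep ;;
  (.const rD 0 ;; .add 0 rOk rD)

/-! ### Memory contents and the test of one exchange -/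

section Correctness

variable {n : ℕ} {A : Fin n → ℤ}

/-- The memory `m` holds the sequence `A` and, behind the address `b`, the indicator of `S`. Apart
from that it agrees with `m₀` at all nonnegative addresses. -/
structure Rep (m₀ : Mem) (A : Fin n → ℤ) (b : ℤ) (S : Finset (Fin n)) (m : Mem) : Prop where
  one : m (-1) = 1
  base : m (-2) = b
  len : m 0 = n
  len_le : (n : ℤ) ≤ b
  seq : ∀ i : Fin n, m ((i : ℕ) + 1) = A i
  mem : ∀ i : Fin n, m (b + ((i : ℕ) + 1)) = if i ∈ S then 1 else 0
  -- This protects the indicator block of one set while the other is being canonicalized.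
  frame : ∀ z, 0 ≤ z → z ≤ b ∨ b + n < z → m z = m₀ z

theorem Rep.congr {m₀ : Mem} {b : ℤ} {S : Finset (Fin n)} {m m' : Mem} (h : Rep m₀ A b S m)
    (hm : ∀ z, -2 ≤ z → m' z = m z) : Rep m₀ A b S m' where
  one := by rw [hm _ (by norm_num), h.one]
  base := by rw [hm _ (by norm_num), h.base]
  len := by rw [hm _ (by norm_num), h.len]
  len_le := h.len_le
  seq i := by rw [hm _ (by omega), h.seq]
  mem i := by have := h.len_le; rw [hm _ (by omega), h.mem]
  frame z hz hz' := by rw [hm _ (by omega), h.frame z hz hz']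

theorem Rep.exchange {m₀ : Mem} {b : ℤ} {S : Finset (Fin n)} {m m' : Mem} {j k : Fin n}
    (h : Rep m₀ A b S m) (hj : m' (b + ((j : ℕ) + 1)) = 1) (hk : m' (b + ((k : ℕ) + 1)) = 0)
    (hjk : j ≠ k)
    (hm : ∀ z, -2 ≤ z → z ≠ b + ((j : ℕ) + 1) → z ≠ b + ((k : ℕ) + 1) → m' z = m z) :
    Rep m₀ A b ((S ∪ {j}) \ {k}) m' := by
  have := h.len_le
  have := j.isLt
  have := k.isLt
  refine ⟨?_, ?_, ?_, h.len_le, fun i => ?_, fun i => ?_, fun z hz hz' => ?_⟩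
  · rw [hm _ (by omega) (by omega) (by omega), h.one]
  · rw [hm _ (by omega) (by omega) (by omega), h.base]
  · rw [hm _ (by omega) (by omega) (by omega), h.len]
  · rw [hm _ (by omega) (by omega) (by omega), h.seq]
  · by_cases h1 : i = j
    · subst h1
      simp [hj, hjk]
    · by_cases h2 : i = k
      · subst h2
        simp [hk]
      · have h1' : (i : ℕ) ≠ j := fun h => h1 (Fin.ext h)
        have h2' : (i : ℕ) ≠ k := fun h => h2 (Fin.ext h)
        rw [hm _ (by omega) (by omega) (by omega), h.mem]
        simp [h1, h2]
  · rw [hm _ (by omega) (by omega) (by omega), h.frame z hz hz']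

/-- The member with index `i` does not prevent the exchange of `k` for a smaller index `j`. -/
def Harmless (A : Fin n → ℤ) (j k i : Fin n) : Prop :=
  (i < j → A i < A j) ∧ (i ≠ k → j < i → A j < A i)

/-- Splits the condition into the part tested up front and the part tested in a loop over `i`. In
the first clause of `Harmless`, `i ≠ k` is automatic from `i < j < k`. -/
theorem canLower_iff {S : Finset (Fin n)} {j k : Fin n} :
    CanLower A S j k ↔ (k ∈ S ∧ j ∉ S ∧ j < k) ∧ ∀ i ∈ S, Harmless A j k i := by
  simp only [CanLower, Harmless]
  constructor
  · rintro ⟨hk, hj, hjk, h⟩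
    exact ⟨⟨hk, hj, hjk⟩, fun i hi => ⟨fun hij => (h i hi (hij.trans hjk).ne).1 hij,
      fun hik => (h i hi hik).2⟩⟩
  · rintro ⟨⟨hk, hj, hjk⟩, h⟩
    exact ⟨hk, hj, hjk, fun i hi hik => ⟨(h i hi).1, (h i hi).2 hik⟩⟩

theorem eval_checkLoad {m₀ : Mem} {b : ℤ} {S : Finset (Fin n)} {m : Mem} {i : Fin n}
    (h : Rep m₀ A b S m) (hi : m rI = (i : ℕ) + 1) :
    checkLoad.eval m rX = (if i ∈ S then 1 else 0) ∧ checkLoad.eval m rV = A i := by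
  have h2 := h.base
  have h3 := h.seq i
  have h4 := h.mem i
  have h5 := h.len_le
  constructor <;>
  simp (disch := omega) only [checkLoad, Prog.eval, Function.update_of_ne,
    Function.update_self, hi, h2, h4, h3]

open Classical in
theorem eval_checkTest {S : Finset (Fin n)} {m : Mem} {j k i : Fin n}
    (hj : m rJ = (j : ℕ) + 1) (hk : m rK = (k : ℕ) + 1) (ha : m rAj = A j)
    (hi : m rI = (i : ℕ) + 1) (hx : m rX = if i ∈ S then 1 else 0) (hv : m rV = A i) :
    checkTest.eval m rOk = if i ∈ S → Harmless A j k i then m rOk else 0 := by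
  simp (disch := omega) only [checkTest, clearUnlessGT, Prog.eval, Function.update_of_ne,
    Function.update_self, ite_apply, hi, hj, hk, ha, hx, hv]
  simp only [Harmless, ne_eq, Fin.lt_def, Fin.ext_iff]
  by_cases hS : i ∈ S
  · simp only [hS, if_true, true_imp_iff]
    split_ifs <;> first | rfl | (exfalso; grind)
  · simp [hS]

open Classical in
theorem run_checkStep {m₀ : Mem} {b : ℤ} {S : Finset (Fin n)} {m : Mem} {j k i : Fin n}
    (h : Rep m₀ A b S m) (hj : m rJ = (j : ℕ) + 1) (hk : m rK = (k : ℕ) + 1)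
    (ha : m rAj = A j) (hi : m rI = (i : ℕ) + 1) :
    ∃ m', Run checkStep m m' 30 ∧ (∀ z, z < -11 ∨ -6 < z → m' z = m z) ∧
      m' rI = (i : ℕ) ∧ m' rOk = if i ∈ S → Harmless A j k i then m rOk else 0 := by
  obtain ⟨hx, hv⟩ := eval_checkLoad h hi
  have hl : ∀ z, z < -11 ∨ -8 < z → checkLoad.eval m z = m z := fun z hz => by
    refine Prog.eval_of_keeps ?_ m
    simp only [checkLoad, Prog.Keeps]
    omega
  have ht : ∀ z, z < -8 ∨ -7 < z →
      checkTest.eval (checkLoad.eval m) z = checkLoad.eval m z := fun z hz => by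
    refine Prog.eval_of_keeps ?_ _
    have : z ≠ -7 := by omega
    have : z ≠ -8 := by omega
    simp only [checkTest, clearUnlessGT, Prog.Keeps, and_true, ne_eq, not_false_eq_true, *]
  have hr := Prog.run_eval (p := checkStep) (by decide) m
  have hok := eval_checkTest (S := S) (A := A) (j := j) (k := k) (i := i) (m := checkLoad.eval m)
    (by rwa [hl _ (by norm_num)]) (by rwa [hl _ (by norm_num)]) (by rwa [hl _ (by norm_num)])
    (by rwa [hl _ (by norm_num)]) hx hv
  refine ⟨_, hr.mono (by decide), fun z hz => ?_, ?_, ?_⟩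
  · simp only [checkStep, Prog.eval]
    rw [Function.update_of_ne (by omega), ht z (by omega), hl z (by omega)]
  · simp only [checkStep, Prog.eval, Function.update_self]
    rw [ht _ (by norm_num), ht _ (by norm_num), hl _ (by norm_num), hl _ (by norm_num), hi, h.one]
    omega
  · simp only [checkStep, Prog.eval]
    rw [Function.update_of_ne (by norm_num), hok, hl _ (by norm_num)]

open Classical in
theorem run_checkLoop {m₀ : Mem} {b : ℤ} {S : Finset (Fin n)} {m : Mem} {j k : Fin n}
    (h : Rep m₀ A b S m) (hj : m rJ = (j : ℕ) + 1) (hk : m rK = (k : ℕ) + 1)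
    (ha : m rAj = A j) (hi : m rI = n) {P : Prop} [Decidable P] (hok : m rOk = if P then 1 else 0) :
    ∃ m', Run (.whilePos rI checkStep) m m' (n * 31 + 1) ∧
      (∀ z, z < -11 ∨ -6 < z → m' z = m z) ∧
      m' rOk = if P ∧ ∀ i ∈ S, Harmless A j k i then 1 else 0 := by
  obtain ⟨m', hr, v, ⟨hv, hvn, hf, hok'⟩, hn⟩ := Run.while (p := checkStep) (s := 30) (a := rI)
    (by decide)
    -- The counter runs downwards, so exactly the indices `i` with `v ≤ i` have been examined; `P`
    -- is the verdict before the loop.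
    (fun v m' => m' rI = v ∧ v ≤ n ∧ (∀ z, z < -11 ∨ -6 < z → m' z = m z) ∧
      m' rOk = if P ∧ ∀ i ∈ S, v ≤ (i : ℕ) → Harmless A j k i then 1 else 0)
    (fun v m' ⟨hv, hvn, hf, hok'⟩ hpos => by
      obtain ⟨u, rfl⟩ : ∃ u, v = u + 1 := ⟨v - 1, by omega⟩
      obtain ⟨m'', hr, hf', hi', hok''⟩ := run_checkStep (m := m') (j := j) (k := k)
        (i := ⟨u, by omega⟩) (h.congr fun z hz => hf z (by omega)) (by rwa [hf _ (by norm_num)])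
        (by rwa [hf _ (by norm_num)]) (by rwa [hf _ (by norm_num)]) (by simpa using hv)
      refine ⟨m'', hr, u, by omega, by simpa using hi', by omega,
        fun z hz => (hf' z hz).trans (hf z hz), ?_⟩
      rw [hok'', hok', ← ite_and]
      refine if_congr ?_ rfl rfl
      constructor
      · rintro ⟨h1, hP, h2⟩
        refine ⟨hP, fun i hi hui => ?_⟩
        rcases hui.eq_or_lt with h | h
        · have e : i = ⟨u, by omega⟩ := Fin.ext h.symm
          exact e ▸ h1 (e ▸ hi)
        · exact h2 i hi h
      · rintro ⟨hP, h1⟩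
        exact ⟨fun hi => h1 _ hi le_rfl, hP, fun i hi hui => h1 i hi (by omega)⟩)
    n m ⟨hi, le_rfl, fun _ _ => rfl, by
      rw [hok]
      exact if_congr ⟨fun hP => ⟨hP, fun i _ h => absurd i.isLt h.not_gt⟩, And.left⟩ rfl rfl⟩
  obtain rfl : v = 0 := by omega
  exact ⟨m', hr, hf, by simpa using hok'⟩

theorem eval_tryLoad {m₀ : Mem} {b : ℤ} {S : Finset (Fin n)} {m : Mem} {j k : Fin n}
    (h : Rep m₀ A b S m) (hj : m rJ = (j : ℕ) + 1) (hk : m rK = (k : ℕ) + 1) :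
    tryLoad.eval m rPj = b + ((j : ℕ) + 1) ∧ tryLoad.eval m rPk = b + ((k : ℕ) + 1) ∧
      tryLoad.eval m rAj = A j ∧ tryLoad.eval m rXj = (if j ∈ S then 1 else 0) ∧
      tryLoad.eval m rXk = (if k ∈ S then 1 else 0) := by
  have h2 := h.base
  have h3 := h.seq j
  have h4 := h.mem j
  have h4' := h.mem k
  have h5 := h.len_le
  refine ⟨?_, ?_, ?_, ?_, ?_⟩ <;>
  simp (disch := omega) only [tryLoad, Prog.eval, Function.update_of_ne,
    Function.update_self, hj, hk, h2, h3, h4, h4']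

theorem eval_tryTest {S : Finset (Fin n)} {m : Mem} {j k : Fin n}
    (hj : m rJ = (j : ℕ) + 1) (hk : m rK = (k : ℕ) + 1) (hxj : m rXj = if j ∈ S then 1 else 0)
    (hxk : m rXk = if k ∈ S then 1 else 0) (hok : m rOk = 0) :
    tryTest.eval m rOk = if k ∈ S ∧ j ∉ S ∧ j < k then 1 else 0 := by
  simp (disch := omega) only [tryTest, Prog.eval, Function.update_of_ne,
    Function.update_self, ite_apply, hj, hk, hxj, hxk, hok]
  simp only [Fin.lt_def]
  split_ifs <;> first | rfl | (exfalso; grind)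

theorem eval_tryPrepare {m₀ : Mem} {b : ℤ} {S : Finset (Fin n)} {m : Mem} {j k : Fin n}
    (h : Rep m₀ A b S m) (hj : m rJ = (j : ℕ) + 1) (hk : m rK = (k : ℕ) + 1) :
    tryPrepare.eval m rPj = b + ((j : ℕ) + 1) ∧ tryPrepare.eval m rPk = b + ((k : ℕ) + 1) ∧
      tryPrepare.eval m rAj = A j ∧ tryPrepare.eval m rI = n ∧
      tryPrepare.eval m rOk = (if k ∈ S ∧ j ∉ S ∧ j < k then 1 else 0) ∧
      ∀ z, -6 < z → tryPrepare.eval m z = m z := by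
  have hl : ∀ z, -12 < z → tryLoad.eval m z = m z := fun z hz => by
    refine Prog.eval_of_keeps ?_ m
    simp only [tryLoad, Prog.Keeps]
    omega
  have ht : ∀ m z, z < -8 ∨ -7 < z → tryTest.eval m z = m z := fun m z hz => by
    refine Prog.eval_of_keeps ?_ m
    have : z ≠ -7 := by omega
    have : z ≠ -8 := by omega
    simp only [tryTest, Prog.Keeps, and_true, ne_eq, not_false_eq_true, *]
  obtain ⟨hpj, hpk, haj, hxj, hxk⟩ := eval_tryLoad h hj hk
  have hn := h.len
  have hn' := h.len
  rw [← hl _ (by norm_num)] at hn hj hk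
  simp only [tryPrepare, Prog.eval]
  generalize tryLoad.eval m = m₁ at *
  refine ⟨?_, ?_, ?_, ?_, eval_tryTest ?_ ?_ ?_ ?_ ?_, fun z hz => ?_⟩
  any_goals rw [ht _ _ (by omega)]
  all_goals simp (disch := omega) only [Function.update_of_ne, Function.update_self, add_zero, *]

theorem run_tryStep {m₀ : Mem} {b : ℤ} {S : Finset (Fin n)} {m : Mem} {j k : Fin n}
    (h : Rep m₀ A b S m) (hj : m rJ = (j : ℕ) + 1) (hk : m rK = (k : ℕ) + 1) :
    ∃ m', Run tryStep m m' (n * 31 + 31) ∧ m' rJ = (j : ℕ) ∧ m' rK = (k : ℕ) + 1 ∧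
      (CanLower A S j k → m' rFlag = 1 ∧ Rep m₀ A b ((S ∪ {j}) \ {k}) m') ∧
      (¬ CanLower A S j k → m' rFlag = m rFlag ∧ Rep m₀ A b S m') := by
  classical
  obtain ⟨hpj, hpk, haj, hi, hok, hp⟩ := eval_tryPrepare h hj hk
  have hr₁ := Prog.run_eval (p := tryPrepare) (by decide) m
  obtain ⟨m₂, hr₂, hf₂, hok₂⟩ := run_checkLoop (m := tryPrepare.eval m) (k := k)
    (h.congr fun z hz => hp z (by omega)) (by rwa [hp _ (by norm_num)])
    (by rwa [hp _ (by norm_num)]) haj hi hok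
  have hr₃ := Prog.run_eval (p := tryFinish) (by decide) m₂
  have hm₂ : ∀ z, -6 < z → m₂ z = m z := fun z hz => (hf₂ z (by omega)).trans (hp z hz)
  have hR : Rep m₀ A b S m₂ := h.congr fun z hz => hm₂ z (by omega)
  rw [← hf₂ _ (by norm_num)] at hpj hpk
  have hj₂ := hj
  have hk₂ := hk
  rw [← hm₂ _ (by norm_num)] at hj₂ hk₂
  have hb := h.len_le
  have h1 := hR.one
  have hfl := hm₂ rFlag (by norm_num)
  replace hok₂ := hok₂.trans (if_congr canLower_iff.symm rfl rfl)
  refine ⟨_, (hr₁.seq (hr₂.seq hr₃)).mono ?_, ?_, ?_, fun hc => ?_, fun hc => ?_⟩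
  · have h1 : tryPrepare.length = 16 := by decide
    have h2 : tryFinish.length = 7 := by decide
    omega
  · simp (disch := omega) only [tryFinish, Prog.eval, Function.update_of_ne,
      Function.update_self, ite_apply, ite_self, hj₂, h1, hpj, hpk]
    omega
  · simp (disch := omega) only [tryFinish, Prog.eval, Function.update_of_ne,
      Function.update_self, ite_apply, ite_self, hk₂, hpj, hpk]
  · have hjk : (j : ℕ) < k := hc.2.2.1
    rw [if_pos hc] at hok₂
    simp only [tryFinish, Prog.eval, hok₂, zero_lt_one, if_true]
    refine ⟨?_, hR.exchange ?_ ?_ hc.2.2.1.ne fun z hz hzj hzk => ?_⟩ <;>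
    simp (disch := omega) only [Function.update_of_ne, Function.update_self, h1, hpj, hpk]
  · rw [if_neg hc] at hok₂
    simp only [tryFinish, Prog.eval, hok₂, lt_irrefl, if_false]
    exact ⟨by rw [Function.update_of_ne (by norm_num), hfl],
      hR.congr fun z hz => Function.update_of_ne (by omega) _ _⟩

/-! ### Sweeps and canonicalization -/

/-- State of the search for a member that can be lowered: the memory holds a set `S` that has been
obtained from `S₀` by lowering, and if the flag is not set, then `S = S₀` and no pair in `D` allows
an exchange. -/
def Swept (m₀ : Mem) (A : Fin n → ℤ) (b : ℤ) (S₀ : Finset (Fin n)) (D : Fin n → Fin n → Prop)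
    (m : Mem) : Prop :=
  ∃ S, Rep m₀ A b S m ∧ Reconfigurable A S₀ S ∧
    (m rFlag = 1 ∧ ∑ i ∈ S, (i : ℕ) < ∑ i ∈ S₀, (i : ℕ) ∨
      m rFlag = 0 ∧ S = S₀ ∧ ∀ j k, D j k → ¬ CanLower A S j k)

theorem Swept.congr {m₀ : Mem} {b : ℤ} {S₀ : Finset (Fin n)} {D D' : Fin n → Fin n → Prop}
    {m m' : Mem} (h : Swept m₀ A b S₀ D m) (hm : ∀ z, -3 ≤ z → m' z = m z)
    (hD : ∀ j k, D' j k → D j k) : Swept m₀ A b S₀ D' m' := by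
  obtain ⟨S, hR, hS, hf⟩ := h
  refine ⟨S, hR.congr fun z hz => hm z (by omega), hS, ?_⟩
  rw [hm _ (by norm_num)]
  exact hf.imp_right fun ⟨h1, h2, h3⟩ => ⟨h1, h2, fun j k h => h3 j k (hD j k h)⟩

/-- Once a lowering has succeeded, earlier failures say nothing about the new set, but the flag
forces another sweep. Only a sweep without success needs its list of failures. -/
theorem run_tryStep_swept {m₀ : Mem} {b : ℤ} {S₀ : Finset (Fin n)} {D : Fin n → Fin n → Prop}
    {m : Mem} {j k : Fin n} (hmax : IsMaximumFeasible A S₀) (h : Swept m₀ A b S₀ D m)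
    (hj : m rJ = (j : ℕ) + 1) (hk : m rK = (k : ℕ) + 1) :
    ∃ m', Run tryStep m m' (n * 31 + 31) ∧ m' rJ = (j : ℕ) ∧ m' rK = (k : ℕ) + 1 ∧
      Swept m₀ A b S₀ (fun j' k' => D j' k' ∨ j' = j ∧ k' = k) m' := by
  obtain ⟨S, hR, hS, hf⟩ := h
  obtain ⟨m', hr, hj', hk', hc, hnc⟩ := run_tryStep hR hj hk
  refine ⟨m', hr, hj', hk', ?_⟩
  by_cases h : CanLower A S j k
  · obtain ⟨hfl, hR'⟩ := hc h
    refine ⟨_, hR', hS.trans (h.reconfigurable (hS.isMaximumFeasible hmax).1), Or.inl ⟨hfl, ?_⟩⟩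
    refine h.sum_lt.trans_le ?_
    rcases hf with hf | hf
    · exact hf.2.le
    · rw [hf.2.1]
  · obtain ⟨hfl, hR'⟩ := hnc h
    refine ⟨S, hR', hS, ?_⟩
    rw [hfl]
    refine hf.imp_right fun ⟨h1, h2, h3⟩ => ⟨h1, h2, ?_⟩
    rintro j' k' (hD | ⟨rfl, rfl⟩)
    exacts [h3 j' k' hD, h]

theorem run_lowerStep {m₀ : Mem} {b : ℤ} {S₀ : Finset (Fin n)} {D : Fin n → Fin n → Prop}
    {m : Mem} {k : Fin n} (hmax : IsMaximumFeasible A S₀) (h : Swept m₀ A b S₀ D m)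
    (hk : m rK = (k : ℕ) + 1) :
    ∃ m', Run lowerStep m m' (n * (n * 31 + 32) + 4) ∧ m' rK = (k : ℕ) ∧
      Swept m₀ A b S₀ (fun j' k' => D j' k' ∨ k' = k) m' := by
  have hr₁ := Prog.run_eval (p := .const rD 0 ;; .add rJ 0 rD) (by decide) m
  have hlen : m 0 = n := h.choose_spec.1.len
  obtain ⟨m', hr₂, v, ⟨hv, hvn, hk', hS⟩, hn⟩ := Run.while (p := tryStep) (s := n * 31 + 31)
    (a := rJ) (by decide)
    (fun v m' => m' rJ = v ∧ v ≤ n ∧ m' rK = (k : ℕ) + 1 ∧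
      Swept m₀ A b S₀ (fun j' k' => D j' k' ∨ v ≤ (j' : ℕ) ∧ k' = k) m')
    (fun v m' ⟨hv, hvn, hk', hS⟩ hpos => by
      obtain ⟨u, rfl⟩ : ∃ u, v = u + 1 := ⟨v - 1, by omega⟩
      obtain ⟨m'', hr, hj'', hk'', hS'⟩ := run_tryStep_swept (j := ⟨u, by omega⟩) hmax hS
        (by simpa using hv) hk'
      refine ⟨m'', hr, u, by omega, by simpa using hj'', by omega, hk'',
        hS'.congr (fun _ _ => rfl) ?_⟩
      rintro j' k' (hD | ⟨hu, rfl⟩)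
      · exact Or.inl (Or.inl hD)
      · rcases hu.eq_or_lt with h | h
        · exact Or.inr ⟨Fin.ext h.symm, rfl⟩
        · exact Or.inl (Or.inr ⟨h, rfl⟩))
    n _ ⟨by simp [Prog.eval, hlen], le_rfl, by simp [Prog.eval, hk], h.congr
      (m' := Prog.eval (.const rD 0 ;; .add rJ 0 rD) m)
      (fun z hz => Prog.eval_of_keeps (by simp only [Prog.Keeps]; omega) m)
      (fun j' k' h => h.resolve_right fun h => absurd j'.isLt h.1.not_gt)⟩
  obtain rfl : v = 0 := by omega
  have hr₃ := Prog.run_eval (p := .sub rK rK rOne) (by decide) m'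
  have h1 : m' rOne = 1 := hS.choose_spec.1.one
  refine ⟨_, (hr₁.seq (hr₂.seq hr₃)).mono ?_, ?_, hS.congr
    (fun z hz => Prog.eval_of_keeps (by simp only [Prog.Keeps]; omega) m') ?_⟩
  · simp only [Prog.length]
    linarith
  · simp [Prog.eval, hk', h1]
  · exact fun j' k' h => h.imp_right fun h => ⟨Nat.zero_le _, h⟩

theorem run_sweep {m₀ : Mem} {b : ℤ} {S : Finset (Fin n)} {m : Mem}
    (hmax : IsMaximumFeasible A S) (h : Rep m₀ A b S m) :
    ∃ m', Run sweep m m' (n * (n * (n * 31 + 32) + 5) + 4) ∧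
      Swept m₀ A b S (fun _ _ => True) m' := by
  have hr₁ := Prog.run_eval (p := .const rFlag 0 ;; .const rD 0 ;; .add rK 0 rD) (by decide) m
  have hlen := h.len
  obtain ⟨m', hr₂, v, ⟨hv, hvn, hS⟩, hn⟩ := Run.while (p := lowerStep)
    (s := n * (n * 31 + 32) + 4) (a := rK) (by decide)
    (fun v m' => m' rK = v ∧ v ≤ n ∧ Swept m₀ A b S (fun _ k' => v ≤ (k' : ℕ)) m')
    (fun v m' ⟨hv, hvn, hS⟩ hpos => by
      obtain ⟨u, rfl⟩ : ∃ u, v = u + 1 := ⟨v - 1, by omega⟩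
      obtain ⟨m'', hr, hk'', hS'⟩ := run_lowerStep (k := ⟨u, by omega⟩) hmax hS
        (by simpa using hv)
      refine ⟨m'', hr, u, by omega, by simpa using hk'', by omega,
        hS'.congr (fun _ _ => rfl) fun j' k' hu => ?_⟩
      rcases hu.eq_or_lt with h | h
      · exact Or.inr (Fin.ext h.symm)
      · exact Or.inl h)
    n _ ⟨by simp [Prog.eval, hlen], le_rfl, S, h.congr
      (m' := Prog.eval (.const rFlag 0 ;; .const rD 0 ;; .add rK 0 rD) m)
      (fun z hz => Prog.eval_of_keeps (by simp only [Prog.Keeps]; omega) m),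
      .refl hmax.1, Or.inr ⟨by simp [Prog.eval], rfl, fun j' k' h => absurd k'.isLt h.not_gt⟩⟩
  obtain rfl : v = 0 := by omega
  refine ⟨_, (hr₁.seq hr₂).mono ?_, hS.congr (fun _ _ => rfl) fun _ _ _ => Nat.zero_le _⟩
  simp only [Prog.length]
  linarith

theorem sum_le_sq (S : Finset (Fin n)) : ∑ i ∈ S, (i : ℕ) ≤ n * n := by
  calc ∑ i ∈ S, (i : ℕ) ≤ ∑ i : Fin n, (i : ℕ) :=
        Finset.sum_le_sum_of_subset (Finset.subset_univ S)
    _ ≤ ∑ _i : Fin n, n := Finset.sum_le_sum fun i _ => i.isLt.le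
    _ = n * n := by simp

theorem run_canonicalize {m₀ : Mem} {b : ℤ} {S : Finset (Fin n)} {m : Mem}
    (hmax : IsMaximumFeasible A S) (h : Rep m₀ A b S m) :
    ∃ m', Run canonicalize m m' ((n * n + 1) * (n * (n * (n * 31 + 32) + 5) + 5) + 2) ∧
      ∃ S', Rep m₀ A b S' m' ∧ Reconfigurable A S S' ∧ ∀ j k, ¬ CanLower A S' j k := by
  have hr₁ := Prog.run_eval (p := .const rFlag 1) (by decide) m
  obtain ⟨m', hr₂, v, ⟨S', hR, hS, hf⟩, hn⟩ := Run.while (p := sweep)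
    (s := n * (n * (n * 31 + 32) + 5) + 4) (a := rFlag) (by decide)
    -- The variant is the index sum, plus one while the flag is set: a successful sweep lowers the
    -- sum, the final one clears the flag.
    (fun v m' => ∃ S', Rep m₀ A b S' m' ∧ Reconfigurable A S S' ∧
      (m' rFlag = 1 ∧ v = ∑ i ∈ S', (i : ℕ) + 1 ∨
        m' rFlag = 0 ∧ v = ∑ i ∈ S', (i : ℕ) ∧ ∀ j k, ¬ CanLower A S' j k))
    (fun v m' ⟨S', hR, hS, hf⟩ hpos => by
      obtain ⟨m'', hr, S'', hR', hS', hf'⟩ := run_sweep (hS.isMaximumFeasible hmax) hR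
      have hv : v = ∑ i ∈ S', (i : ℕ) + 1 := by
        rcases hf with hf | hf
        · exact hf.2
        · exact absurd hpos hf.1.le.not_gt
      refine ⟨m'', hr, ?_⟩
      rcases hf' with ⟨h1, h2⟩ | ⟨h1, rfl, h2⟩
      · exact ⟨_, by omega, S'', hR', hS.trans hS', Or.inl ⟨h1, rfl⟩⟩
      · exact ⟨_, by omega, S'', hR', hS, Or.inr ⟨h1, rfl, fun j k => h2 j k trivial⟩⟩)
    (∑ i ∈ S, (i : ℕ) + 1) _ ⟨S, h.congr (m' := Prog.eval (.const rFlag 1) m)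
      (fun z hz => Prog.eval_of_keeps (by simp only [Prog.Keeps]; omega) m),
      .refl hmax.1, Or.inl ⟨by simp [Prog.eval], rfl⟩⟩
  refine ⟨m', (hr₁.seq hr₂).mono ?_, S', hR, hS, ?_⟩
  · have := sum_le_sq S
    simp only [Prog.length]
    have : (∑ i ∈ S, (i : ℕ) + 1) * (n * (n * (n * 31 + 32) + 5) + 4 + 1) ≤
        (n * n + 1) * (n * (n * (n * 31 + 32) + 5) + 5) := by gcongr
    omega
  · rcases hf with hf | hf
    · exact absurd (hf.1 ▸ one_pos) hn
    · exact hf.2.2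

/-! ### Comparison of the canonical forms -/

theorem eval_compareTest {S S' : Finset (Fin n)} {m : Mem} {i : Fin n}
    (hx : m rX = if i ∈ S' then 1 else 0) (hv : m rV = if i ∈ S then 1 else 0) :
    compareTest.eval m rOk = if i ∈ S ↔ i ∈ S' then m rOk else 0 := by
  have h : ∀ (a : ℤ) (p q : Prog) (m : Mem) (z : ℤ),
      (Prog.ifPos a p q).eval m z = if 0 < m a then p.eval m z else q.eval m z :=
    fun a p q m z => ite_apply _ _ _ _
  have h' : ∀ (p q : Prog) (m : Mem), (Prog.seq p q).eval m = q.eval (p.eval m) :=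
    fun _ _ _ => rfl
  rw [compareTest, h', h, h', h]
  simp (disch := omega) only [Prog.eval, Function.update_of_ne, Function.update_self, hx, hv]
  by_cases hS : i ∈ S <;> by_cases hS' : i ∈ S' <;> simp [hS, hS']

theorem run_compareStep {m₀ : Mem} {S S' : Finset (Fin n)} {m : Mem} {i : Fin n}
    (h : Rep m₀ A (2 * n) S' m) (hS : ∀ i : Fin n, m (n + ((i : ℕ) + 1)) = if i ∈ S then 1 else 0)
    (hi : m rI = (i : ℕ) + 1) :
    ∃ m', Run compareStep m m' 15 ∧ (∀ z, -6 < z → m' z = m z) ∧ m' rI = (i : ℕ) ∧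
      m' rOk = if i ∈ S ↔ i ∈ S' then m rOk else 0 := by
  have h2 := h.base
  have h3 := hS i
  have h4 := h.mem i
  have h5 := h.len
  have hl : ∀ z, z < -11 ∨ -9 < z → compareLoad.eval m z = m z := fun z hz => by
    refine Prog.eval_of_keeps ?_ m
    simp only [compareLoad, Prog.Keeps]
    omega
  have hx : compareLoad.eval m rX = if i ∈ S' then 1 else 0 := by
    simp (disch := omega) only [compareLoad, Prog.eval, Function.update_of_ne,
      Function.update_self, hi, h2, h4]
  have hv : compareLoad.eval m rV = if i ∈ S then 1 else 0 := by
    simp (disch := omega) only [compareLoad, Prog.eval, Function.update_of_ne,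
      Function.update_self, hi, h3, h5]
  have ht : ∀ m z, z < -8 ∨ -7 < z → compareTest.eval m z = m z := fun m z hz => by
    refine Prog.eval_of_keeps ?_ m
    have : z ≠ -7 := by omega
    have : z ≠ -8 := by omega
    simp only [compareTest, Prog.Keeps, and_true, ne_eq, not_false_eq_true, *]
  have hr := Prog.run_eval (p := compareStep) (by decide) m
  refine ⟨_, hr.mono (by decide), fun z hz => ?_, ?_, ?_⟩
  · simp only [compareStep, Prog.eval]
    rw [Function.update_of_ne (by omega), ht _ z (by omega), hl z (by omega)]
  · simp only [compareStep, Prog.eval, Function.update_self]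
    rw [ht _ _ (by norm_num), ht _ _ (by norm_num), hl _ (by norm_num), hl _ (by norm_num), hi,
      h.one]
    omega
  · simp only [compareStep, Prog.eval]
    rw [Function.update_of_ne (by norm_num), eval_compareTest hx hv, hl rOk (by norm_num)]

theorem run_compare {m₀ : Mem} {S S' : Finset (Fin n)} {m : Mem}
    (h : Rep m₀ A (2 * n) S' m) (hS : ∀ i : Fin n, m (n + ((i : ℕ) + 1)) = if i ∈ S then 1 else 0)
    (hi : m rI = n) (hok : m rOk = 1) :
    ∃ m', Run (.whilePos rI compareStep) m m' (n * 16 + 1) ∧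
      m' rOk = if S = S' then 1 else 0 := by
  obtain ⟨m', hr, v, ⟨hv, hvn, hf, hok'⟩, hn⟩ := Run.while (p := compareStep) (s := 15) (a := rI)
    (by decide)
    (fun v m' => m' rI = v ∧ v ≤ n ∧ (∀ z, -6 < z → m' z = m z) ∧
      m' rOk = if ∀ i : Fin n, v ≤ (i : ℕ) → (i ∈ S ↔ i ∈ S') then 1 else 0)
    (fun v m' ⟨hv, hvn, hf, hok'⟩ hpos => by
      obtain ⟨u, rfl⟩ : ∃ u, v = u + 1 := ⟨v - 1, by omega⟩
      obtain ⟨m'', hr, hf', hi', hok''⟩ := run_compareStep (m := m') (S := S) (i := ⟨u, by omega⟩)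
        (h.congr fun z hz => hf z (by omega)) (fun i => by rw [hf _ (by omega), hS])
        (by simpa using hv)
      refine ⟨m'', hr, u, by omega, by simpa using hi', by omega,
        fun z hz => (hf' z hz).trans (hf z hz), ?_⟩
      rw [hok'', hok', ← ite_and]
      refine if_congr ?_ rfl rfl
      constructor
      · rintro ⟨h1, h2⟩ i hui
        rcases hui.eq_or_lt with h | h
        · have e : i = ⟨u, by omega⟩ := Fin.ext h.symm
          rwa [e]
        · exact h2 i h
      · exact fun h1 => ⟨h1 _ le_rfl, fun i hui => h1 i (by omega)⟩)
    n m ⟨hi, le_rfl, fun _ _ => rfl, by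
      rw [hok, if_pos fun i h => absurd i.isLt h.not_gt]⟩
  obtain rfl : v = 0 := by omega
  refine ⟨m', hr, hok'.trans (if_congr ?_ rfl rfl)⟩
  simp [Finset.ext_iff]

/-! ### Input layout and the whole program -/

theorem initMem_encode (x : LISRInstance) :
    initMem x.encode 0 = x.n ∧ (∀ i : Fin x.n, initMem x.encode ((i : ℕ) + 1) = x.A i) ∧
      (∀ i : Fin x.n, initMem x.encode (x.n + ((i : ℕ) + 1)) = if i ∈ x.I then 1 else 0) ∧
      ∀ i : Fin x.n, initMem x.encode (2 * x.n + ((i : ℕ) + 1)) = if i ∈ x.J then 1 else 0 := by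
  have key : ∀ k : ℕ, initMem x.encode ((k : ℤ) + 1) = (x.encode.drop 1).getD k 0 := by
    intro k
    rw [initMem, if_pos (by omega), show ((k : ℤ) + 1).toNat = k + 1 by omega]
    simp [LISRInstance.encode, List.getD]
  refine ⟨by simp [initMem, LISRInstance.encode], fun i => ?_, fun i => ?_, fun i => ?_⟩
  · rw [key]
    simp only [LISRInstance.encode, List.drop_succ_cons, List.drop_zero]
    rw [List.append_assoc, List.getD_append _ _ _ _ (by simp), List.getD_eq_getElem _ _ (by simp)]
    simp
  · rw [← add_assoc, ← Nat.cast_add, key]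
    simp only [LISRInstance.encode, List.drop_succ_cons, List.drop_zero]
    rw [List.getD_append _ _ _ _ (by simp), List.getD_append_right _ _ _ _ (by simp),
      List.getD_eq_getElem _ _ (by simp)]
    simp
  · rw [← add_assoc, show (2 * x.n + (i : ℕ) : ℤ) = ((2 * x.n + i : ℕ) : ℤ) by push_cast; ring, key]
    simp only [LISRInstance.encode, List.drop_succ_cons, List.drop_zero]
    rw [List.getD_append_right _ _ _ _ (by simp; omega),
      List.getD_eq_getElem _ _ (by simp; omega)]
    simp [show 2 * x.n + (i : ℕ) - (x.n + x.n) = i by omega]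

theorem run_decideLISR (x : LISRInstance) :
    ∃ m, Run decideLISR (initMem x.encode) m
        (2 * ((x.n * x.n + 1) * (x.n * (x.n * (x.n * 31 + 32) + 5) + 5)) + x.n * 16 + 20) ∧
      (x.IsYes → m 0 = 1) ∧ (¬ x.IsYes → m 0 = 0) := by
  obtain ⟨hn, hA, hI, hJ⟩ := initMem_encode x
  set m₀ := initMem x.encode
  have hr₁ := Prog.run_eval (p := .const rOne 1 ;; .const rD 0 ;; .add rBase 0 rD) (by decide) m₀
  have hf₁ : ∀ z, 0 ≤ z →
      Prog.eval (.const rOne 1 ;; .const rD 0 ;; .add rBase 0 rD) m₀ z = m₀ z := fun z hz =>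
    Prog.eval_of_keeps (by simp only [Prog.Keeps]; omega) m₀
  have h1 : Rep m₀ x.A x.n x.I
      (Prog.eval (.const rOne 1 ;; .const rD 0 ;; .add rBase 0 rD) m₀) :=
    { one := by simp [Prog.eval]
      base := by simp [Prog.eval, hn]
      len := by rw [hf₁ _ le_rfl, hn]
      len_le := le_rfl
      seq := fun i => by rw [hf₁ _ (by omega), hA]
      mem := fun i => by rw [hf₁ _ (by omega), hI]
      frame := fun z hz _ => hf₁ z hz }
  obtain ⟨m₁, hr₂, I', hI', hII', hminI⟩ := run_canonicalize x.maxI h1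
  have hr₃ := Prog.run_eval (p := .add rBase 0 0) (by decide) m₁
  have hf₂ : ∀ z, z ≠ -2 → Prog.eval (.add rBase 0 0) m₁ z = m₁ z := fun z hz =>
    Prog.eval_of_keeps (p := .add rBase 0 0) hz m₁
  -- The reference memory is reset to the current one, so that the frame now covers the block of
  -- `I'`.
  have h2 : Rep (Prog.eval (.add rBase 0 0) m₁) x.A (2 * x.n) x.J
      (Prog.eval (.add rBase 0 0) m₁) :=
    { one := by rw [hf₂ _ (by norm_num), hI'.one]
      base := by simp only [Prog.eval, Function.update_self, hI'.len]; ring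
      len := by rw [hf₂ _ (by norm_num), hI'.len]
      len_le := by omega
      seq := fun i => by rw [hf₂ _ (by omega), hI'.seq]
      mem := fun i => by rw [hf₂ _ (by omega), hI'.frame _ (by omega) (by omega), hJ]
      frame := fun _ _ _ => rfl }
  obtain ⟨m₂, hr₄, J', hJ', hJJ', hminJ⟩ := run_canonicalize x.maxJ h2
  have hr₅ := Prog.run_eval (p := .const rOk 1 ;; .const rD 0 ;; .add rI 0 rD) (by decide) m₂
  have hf₃ : ∀ z, -6 < z →
      Prog.eval (.const rOk 1 ;; .const rD 0 ;; .add rI 0 rD) m₂ z = m₂ z := fun z hz =>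
    Prog.eval_of_keeps (by simp only [Prog.Keeps]; omega) m₂
  obtain ⟨m₃, hr₆, hok⟩ := run_compare (S := I') (S' := J')
    (m := Prog.eval (.const rOk 1 ;; .const rD 0 ;; .add rI 0 rD) m₂)
    (hJ'.congr fun z hz => hf₃ z (by omega))
    (fun i => by
      rw [hf₃ _ (by omega), hJ'.frame _ (by omega) (by omega), hf₂ _ (by omega), hI'.mem])
    (by simp [Prog.eval, hJ'.len]) (by simp [Prog.eval])
  have hr₇ := Prog.run_eval (p := .const rD 0 ;; .add 0 rOk rD) (by decide) m₃
  have hyes : x.IsYes ↔ I' = J' := by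
    constructor
    · intro h
      exact ((hII'.symm.trans h).trans hJJ').eq_of_not_canLower x.distinct
        (hII'.isMaximumFeasible x.maxI) hminI hminJ
    · rintro rfl
      exact hII'.trans hJJ'.symm
  refine ⟨_, (hr₁.seq (hr₂.seq (hr₃.seq (hr₄.seq (hr₅.seq (hr₆.seq hr₇)))))).mono ?_, ?_, ?_⟩
  · simp only [Prog.length]
    omega
  · intro h
    simp [Prog.eval, hok, hyes.1 h]
  · intro h
    simp [Prog.eval, hok, mt hyes.2 h]

end Correctness

end RAM

theorem theorem1 : RAM.DecidableInPolyTime LISRInstance.encode LISRInstance.IsYes := by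
  refine RAM.DecidableInPolyTime.of_run RAM.decideLISR
    (2 * ((.X * .X + 1) * (.X * (.X * (.X * 31 + 32) + 5) + 5)) + .X * 16 + 20) fun x => ?_
  obtain ⟨m, hr, hm⟩ := RAM.run_decideLISR x
  refine ⟨m, hr.mono ?_, hm⟩
  -- The encoding has `3n + 1` entries, each of at least one bit.
  have hn : x.n ≤ RAM.inputSize x.encode :=
    le_trans (by simp [LISRInstance.encode]; omega) (RAM.length_le_inputSize x.encode)
  simp only [Polynomial.eval_add, Polynomial.eval_mul, Polynomial.eval_X, Polynomial.eval_ofNat,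
    Polynomial.eval_one]
  gcongr
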